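/- There is an absolute constant $C>0$ with the following property. For $k=0,1,2,\dots$ let $n=n_k$, $r=r_k$, $d=d_k$, $m=m_k$ be natural numbers with $n=rd$, let $p=p_k\in(0,\tfrac12]$ and $v=v_k>0$, and let $\mathcal B=\mathcal B_k:\{1,\dots,n\}\to\{1,\dots,r\}$ be a block structure all of whose $r$ blocks $\mathcal B^{-1}(q)$ have $d$ elements. For $z\in\mathbb R^n$ write $z[q]$ for the subvector of the entries $z_i$ with $\mathcal B(i)=q$, and put $\|z\|_{\mathcal B,0}=\#\{q: z[q]\neq 0\}$ and $\|z\|_{\mathcal B,1}=\sum_{q=1}^r\|z[q]\|_2$. Let $A\in\mathbb R^{m\times n}$ be a random matrix with i.i.d. $\mathcal N(0,v)$ entries, and let $x\in\mathbb R^n$ be a random block Bernoulli–Gaussian vector, that is, its blocks $x[1],\dots,x[r]$ are independent and each of them is $0$ with probability $1-p$ and a standard Gaussian vector of $\mathbb R^d$ with probability $p$. (No relation between $A$ and $x$ is required; in particular they may be independent.) Let $\beta=\frac{m}{np}$. Suppose that, as $k\to\infty$, $$n\to\infty,\qquad \log\frac1p=o\!\left(\frac{d}{\log d}\right),\qquad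 \beta\to\infty .$$ (The little-$o$ condition is understood to exclude $d=1$ for large $k$.) Then Bob, who knows $\mathcal B$ and $A$, stably recovers $x$ asymptotically almost surely by block-sparse recovery: with probability tending to $1$ as $k\to\infty$, the following holds both for $F=\|\cdot\|_{\mathcal B,1}$ (the convex program known as Block Basis Pursuit) and for $F=\|\cdot\|_{\mathcal B,0}$ (block-$\ell_0$ minimization). 1. (Exact recovery without noise.) $x$ is the unique solution of $\min_z F(z)$ subject to $Az=Ax$. 2. (Stability.) For all $w\in\mathbb R^m$ and all $\varepsilon\ge\|w\|_2$, the program $\min_z F(z)$ subject to $\|Ax+w-Az\|_2\le\varepsilon$ has a solution, and each of its solutions $\hat x$ satisfies $\|\hat x-x\|_2\le \dfrac{C\,\varepsilon}{\sqrt{m v}}$. -/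

import Mathlib

open MeasureTheory ProbabilityTheory Filter Topology Asymptotics
open scoped NNReal ENNReal

noncomputable section

namespace BlockSparse

/-- `B : Fin n → Fin r` is a block structure with `r` blocks of equal size `d`
(so that `n = r * d`). -/
def IsBlockStructure {n r : ℕ} (B : Fin n → Fin r) (d : ℕ) : Prop :=
  ∀ q : Fin r, Fintype.card {i : Fin n // B i = q} = d

/-- The subvector `x[q]` of `x`, made of the entries `x i` with `B i = q`. -/
def subvector {n r : ℕ} (B : Fin n → Fin r) (x : EuclideanSpace ℝ (Fin n)) (q : Fin r) :
    EuclideanSpace ℝ {i : Fin n // B i = q} :=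
  WithLp.toLp 2 (fun i => x i.1)

open Classical in
/-- The block-`ℓ₀`-norm: the number of blocks of `x` that are not exactly `0`. -/
def blockL0 {n r : ℕ} (B : Fin n → Fin r) (x : EuclideanSpace ℝ (Fin n)) : ℝ :=
  ∑ q : Fin r, if subvector B x q ≠ 0 then 1 else 0

/-- The block-`ℓ₁`-norm (mixed `ℓ₂/ℓ₁`-norm): the sum of the Euclidean norms of the blocks. -/
def blockL1 {n r : ℕ} (B : Fin n → Fin r) (x : EuclideanSpace ℝ (Fin n)) : ℝ :=
  ∑ q : Fin r, ‖subvector B x q‖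

/-- The vector `A x` of noise-free linear measurements of `x`. -/
def measure {m n : ℕ} (A : Matrix (Fin m) (Fin n) ℝ) (x : EuclideanSpace ℝ (Fin n)) :
    EuclideanSpace ℝ (Fin m) :=
  WithLp.toLp 2 (A.mulVec (WithLp.ofLp x))

/-- The set of solutions of the program `min F z` subject to `‖y - A z‖₂ ≤ ε`. -/
def solutions {m n : ℕ} (F : EuclideanSpace ℝ (Fin n) → ℝ) (A : Matrix (Fin m) (Fin n) ℝ)
    (y : EuclideanSpace ℝ (Fin m)) (ε : ℝ) : Set (EuclideanSpace ℝ (Fin n)) :=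
  {z | ‖y - measure A z‖ ≤ ε ∧ ∀ z', ‖y - measure A z'‖ ≤ ε → F z ≤ F z'}

/-- Minimizing `F` recovers `x` from its measurements through `A`, stably with constant `c`: from
the noise-free measurements `A x` the program has `x` as its one and only solution, and from
measurements `A x + w` with `‖w‖₂ ≤ ε` the program has a solution, and all its solutions are
within `c * ε` of `x`. -/
def StablyRecovers {m n : ℕ} (F : EuclideanSpace ℝ (Fin n) → ℝ) (A : Matrix (Fin m) (Fin n) ℝ)
    (x : EuclideanSpace ℝ (Fin n)) (c : ℝ) : Prop :=
  solutions F A (measure A x) 0 = {x} ∧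
  ∀ (w : EuclideanSpace ℝ (Fin m)) (ε : ℝ), ‖w‖ ≤ ε →
    (solutions F A (measure A x + w) ε).Nonempty ∧
    ∀ z ∈ solutions F A (measure A x + w) ε, ‖z - x‖ ≤ c * ε

/-- The entries of the random matrix `A` are independent with law `N(0, v)`. -/
structure IsGaussianMatrix {Ω : Type*} [MeasurableSpace Ω] {m n : ℕ}
    (A : Ω → Matrix (Fin m) (Fin n) ℝ) (v : ℝ≥0) (P : Measure Ω) : Prop where
  indep : iIndepFun (fun (ij : Fin m × Fin n) (ω : Ω) => A ω ij.1 ij.2) P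
  law : ∀ i j, HasLaw (fun ω => A ω i j) (gaussianReal 0 v) P

/-- The random vector `x` has the block Bernoulli–Gaussian distribution with activation
probability `p`: its blocks are independent, and each of them is `0` with probability `1 - p` and
a standard Gaussian vector with probability `p`. -/
structure IsBlockBernoulliGaussian {Ω : Type*} [MeasurableSpace Ω] {n r : ℕ}
    (B : Fin n → Fin r) (p : ℝ) (x : Ω → EuclideanSpace ℝ (Fin n)) (P : Measure Ω) : Prop where
  indep : iIndepFun (fun (q : Fin r) (ω : Ω) => subvector B (x ω) q) P
  law : ∀ q, HasLaw (fun ω => subvector B (x ω) q)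
    (ENNReal.ofReal (1 - p) • Measure.dirac 0 + ENNReal.ofReal p • stdGaussian _) P

/-- The redundancy parameter `β = m / (n p)`. -/
def redundancy (m n : ℕ) (p : ℝ) : ℝ := m / (n * p)

end BlockSparse

end

/-! The proof combines a restricted isometry on block-sparse vectors with Markov's inequality for
the number of nonzero blocks. Put `b = √β` and `S = b r p`, so that `m = b S d`. The expected number
of nonzero blocks is at most `r p`, so `x` has fewer than `S` of them except with probability `1 /
b`.

It remains to bound `A` above and below on vectors with at most `K = 2305 S` blocks. For a fixed
vector `y`, `‖A y‖²` is a scaled chi-square variable with exponentially small tails in `m`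
(`IsGaussianMatrix.measure_norm_le`). A union bound over the supports and over a net in each support
space costs a factor `exp (K log (1/p) + p r + 3 K d)`
(`IsGaussianMatrix.measure_not_restrictedIsometry_le`). As soon as `log (1/p) ≤ d`, which the
little-o condition provides, this exponent is `O(S d) = O(m / b)`, negligible against `m`.

The isometry yields recovery deterministically (`RestrictedIsometry.stablyRecovers`). For
block-`ℓ₁`, the error `z - x` has at least half of its block-`ℓ₁` mass on the support of `x`, and
`A` is bounded below on all such vectors (`RestrictedIsometry.norm_le_of_cone`). For block-`ℓ₀`, the
error is itself block-sparse. -/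

namespace BlockSparse

/-! ### Restricted isometry and the cone condition (deterministic). -/

variable {m n r : ℕ}

/-- The linear map `x ↦ A x` between Euclidean spaces. -/
noncomputable def measureCLM (A : Matrix (Fin m) (Fin n) ℝ) :
    EuclideanSpace ℝ (Fin n) →L[ℝ] EuclideanSpace ℝ (Fin m) :=
  LinearMap.toContinuousLinearMap (Matrix.toEuclideanLin A)

lemma measureCLM_apply (A : Matrix (Fin m) (Fin n) ℝ) (x : EuclideanSpace ℝ (Fin n)) :
    measureCLM A x = measure A x := rfl

/-- The vector that agrees with `h` on the blocks in `T` and vanishes on the others. -/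
noncomputable def restrict (B : Fin n → Fin r) (T : Finset (Fin r))
    (h : EuclideanSpace ℝ (Fin n)) : EuclideanSpace ℝ (Fin n) :=
  WithLp.toLp 2 (fun i => if B i ∈ T then h i else 0)

lemma restrict_apply (B : Fin n → Fin r) (T : Finset (Fin r)) (h : EuclideanSpace ℝ (Fin n))
    (i : Fin n) : restrict B T h i = if B i ∈ T then h i else 0 := rfl

lemma restrict_union (B : Fin n → Fin r) {T T' : Finset (Fin r)} (hT : Disjoint T T')
    (h : EuclideanSpace ℝ (Fin n)) :
    restrict B (T ∪ T') h = restrict B T h + restrict B T' h := by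
  ext i
  rw [PiLp.add_apply]
  simp only [restrict_apply, Finset.mem_union]
  by_cases h1 : B i ∈ T
  · have h2 : B i ∉ T' := Finset.disjoint_left.mp hT h1
    simp [h1, h2]
  · simp [h1]

lemma restrict_univ (B : Fin n → Fin r) (h : EuclideanSpace ℝ (Fin n)) :
    restrict B Finset.univ h = h := by
  ext i
  simp [restrict_apply]

lemma norm_sq_subvector (B : Fin n → Fin r) (h : EuclideanSpace ℝ (Fin n)) (q : Fin r) :
    ‖subvector B h q‖ ^ 2 = ∑ i with B i = q, h i ^ 2 := by
  rw [EuclideanSpace.real_norm_sq_eq, Finset.sum_subtype (p := fun i => B i = q)]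
  · rfl
  · simp

lemma norm_sq_restrict (B : Fin n → Fin r) (T : Finset (Fin r))
    (h : EuclideanSpace ℝ (Fin n)) :
    ‖restrict B T h‖ ^ 2 = ∑ q ∈ T, ‖subvector B h q‖ ^ 2 := by
  simp_rw [norm_sq_subvector, Finset.sum_filter]
  rw [EuclideanSpace.real_norm_sq_eq, Finset.sum_comm]
  refine Finset.sum_congr rfl fun i _ => ?_
  simp [restrict_apply]

lemma subvector_sub (B : Fin n → Fin r) (x y : EuclideanSpace ℝ (Fin n)) (q : Fin r) :
    subvector B (x - y) q = subvector B x q - subvector B y q := rfl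

lemma restrict_eq_self (B : Fin n → Fin r) {T : Finset (Fin r)} {h : EuclideanSpace ℝ (Fin n)}
    (hT : ∀ q ∉ T, subvector B h q = 0) : restrict B T h = h := by
  ext i
  rw [restrict_apply]
  split_ifs with hi
  · rfl
  · have := congrArg (fun z => z ⟨i, rfl⟩) (hT _ hi)
    exact this.symm

lemma eq_zero_of_subvector_eq_zero (B : Fin n → Fin r) {h : EuclideanSpace ℝ (Fin n)}
    (hT : ∀ q, subvector B h q = 0) : h = 0 := by
  have h0 := norm_sq_restrict B Finset.univ h
  rw [restrict_univ] at h0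
  simpa [hT] using h0

lemma exists_largest_subset {α : Type*} [DecidableEq α] (f : α → ℝ) (T : Finset α) (M : ℕ) :
    ∃ S ⊆ T, S.card = min M T.card ∧ ∀ a ∈ S, ∀ b ∈ T \ S, f b ≤ f a := by
  induction M with
  | zero => exact ⟨∅, by simp, by simp, by simp⟩
  | succ M ih =>
    obtain ⟨S, hST, hS, hf⟩ := ih
    rcases (T \ S).eq_empty_or_nonempty with he | hne
    · refine ⟨S, hST, ?_, hf⟩
      have h1 : T ⊆ S := Finset.sdiff_eq_empty_iff_subset.mp he
      have h2 := Finset.card_le_card h1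
      omega
    · obtain ⟨a, ha, hmax⟩ := Finset.exists_max_image (T \ S) f hne
      have haT := (Finset.mem_sdiff.mp ha).1
      have haS := (Finset.mem_sdiff.mp ha).2
      refine ⟨insert a S, Finset.insert_subset haT hST, ?_, ?_⟩
      · have h1 : (insert a S).card ≤ T.card :=
          Finset.card_le_card (Finset.insert_subset haT hST)
        rw [Finset.card_insert_of_notMem haS] at h1 ⊢
        omega
      · intro b hb c hc
        rw [Finset.mem_sdiff, Finset.mem_insert, not_or] at hc
        have hc' : c ∈ T \ S := Finset.mem_sdiff.mpr ⟨hc.1, hc.2.2⟩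
        rcases Finset.mem_insert.mp hb with rfl | hb
        · exact hmax c hc'
        · exact hf b hb c hc'

/-- A nonempty remainder `T \ S` forces `S` to have exactly `M` elements, each with value at least
`f b`. -/
lemma card_mul_le_sum_of_largest {α : Type*} [DecidableEq α] {f : α → ℝ} {S T : Finset α}
    {M : ℕ} (hc : S.card = min M T.card) (hST : S ⊆ T)
    (hf : ∀ a ∈ S, ∀ b ∈ T \ S, f b ≤ f a) {b : α} (hb : b ∈ T \ S) :
    M * f b ≤ ∑ a ∈ S, f a := by
  have h1 : S.card < T.card := Finset.card_lt_card
    (Finset.ssubset_iff_subset_ne.mpr ⟨hST, fun h => by simp [h] at hb⟩)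
  have h2 : S.card = M := by omega
  rw [← h2, ← nsmul_eq_mul]
  exact Finset.card_nsmul_le_sum _ _ _ fun a ha => hf a ha b hb

lemma norm_restrict_le_of_forall_le (B : Fin n → Fin r) {T : Finset (Fin r)}
    {h : EuclideanSpace ℝ (Fin n)} {M : ℕ} (hT : T.card ≤ M) {c : ℝ} (hc : 0 ≤ c)
    (hb : ∀ q ∈ T, ‖subvector B h q‖ ≤ c) : ‖restrict B T h‖ ≤ c * √M := by
  refine abs_le_of_sq_le_sq' ?_ (by positivity) |>.2
  rw [norm_sq_restrict, mul_pow, Real.sq_sqrt (Nat.cast_nonneg _)]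
  calc ∑ q ∈ T, ‖subvector B h q‖ ^ 2 ≤ ∑ _q ∈ T, c ^ 2 :=
        Finset.sum_le_sum fun q hq => by gcongr; exact hb q hq
    _ = T.card * c ^ 2 := by simp
    _ ≤ c ^ 2 * M := by
        rw [mul_comm]; gcongr

/-- If `L` is bounded by `κ` on the vectors with at most `M` blocks, then on an arbitrary vector
it is bounded by `κ` times a mixed norm. -/
lemma norm_map_restrict_le {F : Type*} [NormedAddCommGroup F] [NormedSpace ℝ F]
    (B : Fin n → Fin r) (L : EuclideanSpace ℝ (Fin n) →L[ℝ] F) {κ : ℝ} (hκ : 0 ≤ κ) {M : ℕ}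
    (hM : 0 < M) (h : EuclideanSpace ℝ (Fin n))
    (hL : ∀ T : Finset (Fin r), T.card ≤ M → ‖L (restrict B T h)‖ ≤ κ * ‖restrict B T h‖)
    (T : Finset (Fin r)) (c : ℝ) (hc : 0 ≤ c) (hb : ∀ q ∈ T, ‖subvector B h q‖ ≤ c) :
    ‖L (restrict B T h)‖ ≤ κ * (c * √M + (∑ q ∈ T, ‖subvector B h q‖) / √M) := by
  have hM' : 0 < √(M : ℝ) := Real.sqrt_pos.mpr (by exact_mod_cast hM)
  induction T using Finset.strongInduction generalizing c with
  | H T ih =>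
    by_cases hT : T.card ≤ M
    · refine (hL T hT).trans ?_
      gcongr
      have := norm_restrict_le_of_forall_le B hT hc hb
      have h2 : 0 ≤ (∑ q ∈ T, ‖subvector B h q‖) / √M := by positivity
      linarith
    · obtain ⟨S, hST, hS, hf⟩ := exists_largest_subset (fun q => ‖subvector B h q‖) T M
      have hSM : S.card = M := by omega
      have hne : S.Nonempty := Finset.card_pos.mp (by omega)
      -- Each remaining block is at most the average over `S`; times `√M` this is the share of `S`
      -- in the sum divided by `√M`. The bounds therefore telescope as batches of `M` blocks are
      -- peeled off.
      have h1 := ih (T \ S) (Finset.sdiff_ssubset hST hne)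
        ((∑ q ∈ S, ‖subvector B h q‖) / M) (by positivity) (fun q hq => by
          rw [le_div_iff₀ (by exact_mod_cast hM), mul_comm]
          exact card_mul_le_sum_of_largest hS hST hf hq)
      have h2 := (hL S hSM.le).trans (mul_le_mul_of_nonneg_left
        (norm_restrict_le_of_forall_le B hSM.le hc fun q hq => hb q (hST hq)) hκ)
      have h3 : restrict B T h = restrict B S h + restrict B (T \ S) h := by
        rw [← restrict_union B Finset.disjoint_sdiff, Finset.union_sdiff_of_subset hST]
      have h4 : (∑ q ∈ S, ‖subvector B h q‖) / M * √M
          = (∑ q ∈ S, ‖subvector B h q‖) / √M := by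
        rw [div_mul_eq_mul_div, div_eq_div_iff (by positivity) hM'.ne', mul_assoc,
          Real.mul_self_sqrt (Nat.cast_nonneg _)]
      have h5 := Finset.sum_sdiff hST (f := fun q => ‖subvector B h q‖)
      rw [h3, map_add, ← h5, add_div]
      rw [h4] at h1
      refine (norm_add_le _ _).trans ((add_le_add h2 h1).trans (le_of_eq ?_))
      ring

/-- `A` is bounded from above and from below on the vectors with at most `K` nonzero blocks. -/
def RestrictedIsometry (B : Fin n → Fin r) (A : Matrix (Fin m) (Fin n) ℝ) (s K : ℝ) : Prop :=
  ∀ T : Finset (Fin r), (T.card : ℝ) ≤ K → ∀ h : EuclideanSpace ℝ (Fin n),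
    s / 8 * ‖restrict B T h‖ ≤ ‖measureCLM A (restrict B T h)‖ ∧
      ‖measureCLM A (restrict B T h)‖ ≤ 3 * s * ‖restrict B T h‖

/-- Split `h = u + w`, where `u` collects `T` and the largest blocks outside `T`. The tail `w` is
spread over small blocks, so `‖A w‖` is at most half of the lower bound for `‖A u‖`, and `‖w‖ ≤
‖u‖`. -/
lemma RestrictedIsometry.norm_le_of_cone {B : Fin n → Fin r} {A : Matrix (Fin m) (Fin n) ℝ}
    {s K : ℝ} (hs : 0 < s) (hA : RestrictedIsometry B A s K) (T : Finset (Fin r))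
    (hT : 2305 * (T.card : ℝ) ≤ K) (h : EuclideanSpace ℝ (Fin n))
    (hcone : ∑ q ∈ Tᶜ, ‖subvector B h q‖ ≤ ∑ q ∈ T, ‖subvector B h q‖) :
    s * ‖h‖ ≤ 32 * ‖measureCLM A h‖ := by
  rcases T.eq_empty_or_nonempty with rfl | hne
  · have h0 : h = 0 := by
      refine eq_zero_of_subvector_eq_zero B fun q => ?_
      rw [Finset.sum_empty] at hcone
      have h1 : ‖subvector B h q‖ ≤ ∑ q ∈ ∅ᶜ, ‖subvector B h q‖ :=
        Finset.single_le_sum (f := fun q => ‖subvector B h q‖) (fun _ _ => norm_nonneg _)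
          (by simp)
      exact norm_le_zero_iff.mp (h1.trans hcone)
    simp [h0]
  set N := T.card with hN
  have hNpos : 0 < N := Finset.card_pos.mpr hne
  -- As `2304 = 48²`, the tail estimate is `3 s / 48 = s / 16`, half of the lower constant `s / 8`.
  -- Together with `T` there are at most `2305 N` blocks.
  obtain ⟨M, hM⟩ : ∃ M : ℕ, M = 2304 * N := ⟨_, rfl⟩
  have hMcast : (M : ℝ) = 2304 * N := by rw [hM]; push_cast; rfl
  obtain ⟨S, hST, hS, hf⟩ := exists_largest_subset (fun q => ‖subvector B h q‖) Tᶜ M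
  have hSle : S.card ≤ 2304 * N := hM ▸ hS ▸ min_le_left _ _
  have hdisj : Disjoint T S :=
    Finset.disjoint_left.mpr fun q hq hq' => (Finset.mem_compl.mp (hST hq')) hq
  set R := Tᶜ \ S with hR
  have hdR : Disjoint (T ∪ S) R := by
    rw [Finset.disjoint_left]
    intro q hq hq'
    rw [hR, Finset.mem_sdiff, Finset.mem_compl] at hq'
    rcases Finset.mem_union.mp hq with h | h
    · exact hq'.1 h
    · exact hq'.2 h
  have hun : (T ∪ S) ∪ R = Finset.univ := by
    ext q
    simp only [hR, Finset.mem_union, Finset.mem_sdiff, Finset.mem_compl, Finset.mem_univ, iff_true]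
    tauto
  have hdec : restrict B (T ∪ S) h + restrict B R h = h := by
    rw [← restrict_union B hdR, hun, restrict_univ]
  set u := restrict B (T ∪ S) h with hu
  set w := restrict B R h with hw
  set c := (∑ q ∈ S, ‖subvector B h q‖) / M with hc
  have hMpos : 0 < M := by omega
  have hcb : ∀ q ∈ R, ‖subvector B h q‖ ≤ c := fun q hq => by
    rw [hc, le_div_iff₀ (by exact_mod_cast hMpos), mul_comm]
    exact card_mul_le_sum_of_largest hS hST hf hq
  have hsum : ∑ q ∈ R, ‖subvector B h q‖ + ∑ q ∈ S, ‖subvector B h q‖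
      = ∑ q ∈ Tᶜ, ‖subvector B h q‖ := Finset.sum_sdiff hST
  set a := √(N : ℝ) with ha
  have hapos : 0 < a := Real.sqrt_pos.mpr (by exact_mod_cast hNpos)
  have ha2 : a ^ 2 = N := Real.sq_sqrt (Nat.cast_nonneg _)
  have hsqrt : √(M : ℝ) = 48 * a := by
    rw [ha, hMcast, Real.sqrt_mul (by norm_num)]
    congr 1
    rw [show (2304 : ℝ) = 48 ^ 2 by norm_num, Real.sqrt_sq (by norm_num)]
  have hSU : T ⊆ T ∪ S := Finset.subset_union_left
  have hT1 : ∑ q ∈ T, ‖subvector B h q‖ ≤ a * ‖u‖ := by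
    refine abs_le_of_sq_le_sq' ?_ (by positivity) |>.2
    rw [mul_pow, ha2, hu, norm_sq_restrict]
    refine (sq_sum_le_card_mul_sum_sq).trans ?_
    gcongr
  have hw1 : ‖measureCLM A w‖ ≤ s / 16 * ‖u‖ := by
    have h1 := norm_map_restrict_le B (measureCLM A) (κ := 3 * s) (by positivity) hMpos h
      (fun T' hT' => (hA T' (by
        have : (T'.card : ℝ) ≤ 2304 * N := by
          rw [← hMcast]; exact_mod_cast hT'
        have : (0 : ℝ) ≤ N := Nat.cast_nonneg _
        linarith) h).2) R c (by positivity) hcb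
    rw [hsqrt] at h1
    have h2 : c * (48 * a) + (∑ q ∈ R, ‖subvector B h q‖) / (48 * a)
        = (∑ q ∈ Tᶜ, ‖subvector B h q‖) / (48 * a) := by
      rw [← hsum, hc, hMcast, ← ha2]
      field_simp
      ring
    rw [h2] at h1
    refine h1.trans ?_
    have h3 : (∑ q ∈ Tᶜ, ‖subvector B h q‖) / (48 * a) ≤ ‖u‖ / 48 := by
      rw [div_le_div_iff₀ (by positivity) (by norm_num)]
      nlinarith [hcone.trans hT1]
    calc _ ≤ 3 * s * (‖u‖ / 48) := by gcongr
      _ = _ := by ring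
  have hw2 : ‖w‖ ≤ ‖u‖ := by
    refine abs_le_of_sq_le_sq' ?_ (by positivity) |>.2
    rw [hw, norm_sq_restrict]
    have hR0 : 0 ≤ ∑ q ∈ R, ‖subvector B h q‖ := by positivity
    have hS0 : 0 ≤ ∑ q ∈ S, ‖subvector B h q‖ := by positivity
    have h1 : ∑ q ∈ R, ‖subvector B h q‖ ^ 2 ≤ c * ∑ q ∈ R, ‖subvector B h q‖ := by
      rw [Finset.mul_sum]
      refine Finset.sum_le_sum fun q hq => ?_
      rw [sq]
      exact mul_le_mul_of_nonneg_right (hcb q hq) (norm_nonneg _)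
    refine h1.trans ?_
    have h2 : c * (2304 * a ^ 2) = ∑ q ∈ S, ‖subvector B h q‖ := by
      rw [hc, ha2, hMcast]; field_simp
    have h3 := hcone.trans hT1
    rw [← hsum] at h3
    have h4 : (∑ q ∈ S, ‖subvector B h q‖) * ∑ q ∈ R, ‖subvector B h q‖ ≤ (a * ‖u‖) * (a * ‖u‖) :=
      mul_le_mul (by linarith) (by linarith) hR0 (by positivity)
    rw [← h2] at h4
    have h5 : a ^ 2 * (2304 * (c * ∑ q ∈ R, ‖subvector B h q‖)) ≤ a ^ 2 * ‖u‖ ^ 2 := by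
      linarith
    have h6 := le_of_mul_le_mul_left h5 (by positivity)
    have : 0 ≤ c * ∑ q ∈ R, ‖subvector B h q‖ := by positivity
    linarith
  have hu1 := (hA (T ∪ S) (by
    have h1 : (T ∪ S).card ≤ 2305 * N := by
      have := Finset.card_union_le T S; omega
    have h2 : ((T ∪ S).card : ℝ) ≤ 2305 * N := by exact_mod_cast h1
    linarith) h).1
  have hn : ‖h‖ ≤ ‖u‖ + ‖w‖ := by
    rw [← hdec]
    exact norm_add_le _ _
  have hm : ‖measureCLM A u‖ ≤ ‖measureCLM A h‖ + ‖measureCLM A w‖ := by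
    have : measureCLM A u = measureCLM A h - measureCLM A w := by
      rw [← hdec, map_add, add_sub_cancel_right]
    rw [this]
    exact norm_sub_le _ _
  -- Here `s / 8 * ‖u‖ ≤ ‖A h‖ + s / 16 * ‖u‖` and `‖h‖ ≤ 2 ‖u‖`.
  nlinarith

/-! ### From restricted isometry to stable recovery. -/

open Classical in
/-- The set of the nonzero blocks of `x`. -/
noncomputable def blockSupport (B : Fin n → Fin r) (x : EuclideanSpace ℝ (Fin n)) :
    Finset (Fin r) := {q | subvector B x q ≠ 0}

lemma notMem_blockSupport {B : Fin n → Fin r} {x : EuclideanSpace ℝ (Fin n)} {q : Fin r} :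
    q ∉ blockSupport B x ↔ subvector B x q = 0 := by
  simp [blockSupport]

lemma blockL0_eq_card (B : Fin n → Fin r) (x : EuclideanSpace ℝ (Fin n)) :
    blockL0 B x = (blockSupport B x).card := by
  simp only [blockL0, blockSupport, Finset.sum_boole]

/-- The triangle inequality on the support of `x` turns `blockL1 B z ≤ blockL1 B x` into the cone
condition for `z - x`. -/
lemma RestrictedIsometry.norm_sub_le_of_blockL1_le {B : Fin n → Fin r}
    {A : Matrix (Fin m) (Fin n) ℝ} {s K : ℝ} (hs : 0 < s) (hA : RestrictedIsometry B A s K)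
    {x z : EuclideanSpace ℝ (Fin n)} (hx : 2305 * ((blockSupport B x).card : ℝ) ≤ K)
    (hz : blockL1 B z ≤ blockL1 B x) :
    s * ‖z - x‖ ≤ 32 * ‖measureCLM A (z - x)‖ := by
  set T := blockSupport B x with hT
  refine hA.norm_le_of_cone hs T hx _ ?_
  have h1 : ∑ q ∈ Tᶜ, ‖subvector B (z - x) q‖ = ∑ q ∈ Tᶜ, ‖subvector B z q‖ := by
    refine Finset.sum_congr rfl fun q hq => ?_
    rw [subvector_sub, notMem_blockSupport.mp (Finset.mem_compl.mp hq), sub_zero]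
  have h2 : ∑ q ∈ Tᶜ, ‖subvector B x q‖ = 0 := Finset.sum_eq_zero fun q hq => by
    rw [notMem_blockSupport.mp (Finset.mem_compl.mp hq), norm_zero]
  have h3 : ∑ q ∈ T, ‖subvector B x q‖ ≤
      ∑ q ∈ T, ‖subvector B (z - x) q‖ + ∑ q ∈ T, ‖subvector B z q‖ := by
    rw [← Finset.sum_add_distrib]
    refine Finset.sum_le_sum fun q _ => ?_
    rw [subvector_sub, norm_sub_rev]
    exact norm_le_norm_sub_add _ _
  unfold blockL1 at hz
  rw [← Finset.sum_add_sum_compl T, ← Finset.sum_add_sum_compl T, h2] at hz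
  linarith

/-- The difference `z - x` has at most twice as many nonzero blocks as `x`, so the lower isometry
bound applies to it directly. -/
lemma RestrictedIsometry.norm_sub_le_of_blockL0_le {B : Fin n → Fin r}
    {A : Matrix (Fin m) (Fin n) ℝ} {s K : ℝ} (hA : RestrictedIsometry B A s K)
    {x z : EuclideanSpace ℝ (Fin n)} (hx : 2305 * ((blockSupport B x).card : ℝ) ≤ K)
    (hz : blockL0 B z ≤ blockL0 B x) :
    s * ‖z - x‖ ≤ 32 * ‖measureCLM A (z - x)‖ := by
  rw [blockL0_eq_card, blockL0_eq_card] at hz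
  have h1 := (hA (blockSupport B z ∪ blockSupport B x) (by
    have h1 : ((blockSupport B z ∪ blockSupport B x).card : ℝ) ≤
      (blockSupport B z).card + (blockSupport B x).card := by
        exact_mod_cast Finset.card_union_le _ _
    have : (0 : ℝ) ≤ (blockSupport B x).card := Nat.cast_nonneg _
    linarith) (z - x)).1
  rw [restrict_eq_self] at h1
  · nlinarith [norm_nonneg (measureCLM A (z - x))]
  · intro q hq
    rw [Finset.mem_union, not_or, notMem_blockSupport, notMem_blockSupport] at hq
    rw [subvector_sub, hq.1, hq.2, sub_zero]

/-- A bound for all the vectors `z` that are at least as good as `x` entails stable recovery, as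
soon as the program attains its minimum on nonempty compact sets. -/
lemma stablyRecovers_of_bound {F : EuclideanSpace ℝ (Fin n) → ℝ} {A : Matrix (Fin m) (Fin n) ℝ}
    {x : EuclideanSpace ℝ (Fin n)} {c : ℝ}
    (hmin : ∀ s : Set (EuclideanSpace ℝ (Fin n)), IsClosed s →
      Bornology.IsBounded {z ∈ s | F z ≤ F x} → x ∈ s → ∃ z ∈ s, ∀ z' ∈ s, F z ≤ F z')
    (hc : ∀ z, F z ≤ F x → ‖z - x‖ ≤ c / 2 * ‖measureCLM A (z - x)‖) (hc0 : 0 ≤ c) :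
    StablyRecovers F A x c := by
  have key : ∀ (w : EuclideanSpace ℝ (Fin m)) (ε : ℝ), ‖w‖ ≤ ε → ∀ z,
      ‖measure A x + w - measure A z‖ ≤ ε → F z ≤ F x → ‖z - x‖ ≤ c * ε := by
    intro w ε hw z hz hF
    -- Both `z` and `x` are feasible; this doubling is the reason for `c / 2` in `hc`.
    have h1 : ‖measureCLM A (z - x)‖ ≤ 2 * ε := by
      have : measureCLM A (z - x) = w - (measure A x + w - measure A z) := by
        rw [map_sub, measureCLM_apply, measureCLM_apply]; abel
      rw [this]
      exact (norm_sub_le _ _).trans (by linarith)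
    calc ‖z - x‖ ≤ c / 2 * ‖measureCLM A (z - x)‖ := hc z hF
      _ ≤ c / 2 * (2 * ε) := by gcongr
      _ = c * ε := by ring
  have feas : ∀ (w : EuclideanSpace ℝ (Fin m)) (ε : ℝ), ‖w‖ ≤ ε →
      ‖measure A x + w - measure A x‖ ≤ ε := by
    intro w ε hw
    simpa using hw
  have exact_of_feas : ∀ z, ‖measure A x - measure A z‖ ≤ 0 → F z ≤ F x → z = x := by
    intro z hz hF
    have := key 0 0 (by simp) z (by simpa using hz) hF
    rw [mul_zero] at this
    exact sub_eq_zero.mp (norm_le_zero_iff.mp this)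
  refine ⟨?_, fun w ε hw => ⟨?_, fun z hz => key w ε hw z hz.1 (hz.2 x (feas w ε hw))⟩⟩
  · ext z
    rw [Set.mem_singleton_iff]
    constructor
    · intro hz
      exact exact_of_feas z hz.1 (hz.2 x (by simp))
    · rintro rfl
      refine ⟨by simp, fun z' hz' => ?_⟩
      by_contra hlt
      have := exact_of_feas z' hz' (not_le.mp hlt).le
      exact hlt (this ▸ le_rfl)
  · have hcont : Continuous fun z => ‖measure A x + w - measure A z‖ := by
      have := (measureCLM A).continuous
      simp_rw [← measureCLM_apply]
      fun_prop
    obtain ⟨z, hz, hz'⟩ := hmin {z | ‖measure A x + w - measure A z‖ ≤ ε}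
      (isClosed_le hcont continuous_const)
      ((Metric.isBounded_closedBall (x := x) (r := c * ε)).subset fun z hz => by
        rw [Metric.mem_closedBall, dist_eq_norm]
        exact key w ε hw z hz.1 hz.2) (feas w ε hw)
    exact ⟨z, hz, hz'⟩

lemma continuous_blockL1 (B : Fin n → Fin r) : Continuous (blockL1 B) := by
  unfold blockL1 subvector
  fun_prop

lemma exists_isMinOn_blockL1 (B : Fin n → Fin r) {x : EuclideanSpace ℝ (Fin n)}
    {s : Set (EuclideanSpace ℝ (Fin n))} (hs : IsClosed s)
    (hb : Bornology.IsBounded {z ∈ s | blockL1 B z ≤ blockL1 B x}) (hx : x ∈ s) :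
    ∃ z ∈ s, ∀ z' ∈ s, blockL1 B z ≤ blockL1 B z' := by
  have hcpt : IsCompact {z ∈ s | blockL1 B z ≤ blockL1 B x} :=
    Metric.isCompact_of_isClosed_isBounded
      (hs.inter (isClosed_le (continuous_blockL1 B) continuous_const)) hb
  obtain ⟨z, hz, hmin⟩ := hcpt.exists_isMinOn ⟨x, hx, le_rfl⟩ (continuous_blockL1 B).continuousOn
  refine ⟨z, hz.1, fun z' hz' => ?_⟩
  by_cases hle : blockL1 B z' ≤ blockL1 B x
  · exact hmin ⟨hz', hle⟩
  · exact hz.2.trans (not_le.mp hle).le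

/-- `blockL0` takes natural values, so well-foundedness replaces compactness. -/
lemma exists_isMinOn_blockL0 (B : Fin n → Fin r) {s : Set (EuclideanSpace ℝ (Fin n))}
    (hne : s.Nonempty) :
    ∃ z ∈ s, ∀ z' ∈ s, blockL0 B z ≤ blockL0 B z' := by
  obtain ⟨z, hz, hmin⟩ := WellFounded.has_min
    (InvImage.wf (fun z => (blockSupport B z).card) wellFounded_lt) s hne
  refine ⟨z, hz, fun z' hz' => ?_⟩
  rw [blockL0_eq_card, blockL0_eq_card]
  exact_mod_cast not_lt.mp (hmin z' hz')

lemma RestrictedIsometry.stablyRecovers {B : Fin n → Fin r}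
    {A : Matrix (Fin m) (Fin n) ℝ} {s K : ℝ} (hs : 0 < s) (hA : RestrictedIsometry B A s K)
    {x : EuclideanSpace ℝ (Fin n)} (hx : 2305 * ((blockSupport B x).card : ℝ) ≤ K) :
    StablyRecovers (blockL1 B) A x (64 / s) ∧ StablyRecovers (blockL0 B) A x (64 / s) := by
  have aux : ∀ z, s * ‖z - x‖ ≤ 32 * ‖measureCLM A (z - x)‖ →
      ‖z - x‖ ≤ 64 / s / 2 * ‖measureCLM A (z - x)‖ := by
    intro z hz
    rw [div_div, div_mul_eq_mul_div, le_div_iff₀ (by positivity)]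
    linarith
  exact ⟨stablyRecovers_of_bound (fun t ht hb hxt => exists_isMinOn_blockL1 B ht hb hxt)
      (fun z hz => aux z (hA.norm_sub_le_of_blockL1_le hs hx hz)) (by positivity),
    stablyRecovers_of_bound (fun t _ _ hxt => exists_isMinOn_blockL0 B ⟨x, hxt⟩)
      (fun z hz => aux z (hA.norm_sub_le_of_blockL0_le hx hz)) (by positivity)⟩

/-- For `x = 0`, any `z` with `F z ≤ F x` vanishes, whatever `A` is. This serves the regime `S < 1`,
where `m` may be too small for the isometry. -/
lemma stablyRecovers_of_blockSupport_eq_empty {B : Fin n → Fin r}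
    (A : Matrix (Fin m) (Fin n) ℝ) {x : EuclideanSpace ℝ (Fin n)} (hx : blockSupport B x = ∅)
    {c : ℝ} (hc : 0 ≤ c) :
    StablyRecovers (blockL1 B) A x c ∧ StablyRecovers (blockL0 B) A x c := by
  have hx0 : ∀ q, subvector B x q = 0 := fun q => notMem_blockSupport.mp (by simp [hx])
  have aux : ∀ z, (∀ q, subvector B z q = 0) →
      ‖z - x‖ ≤ c / 2 * ‖measureCLM A (z - x)‖ := by
    intro z hz
    rw [eq_zero_of_subvector_eq_zero B hz, eq_zero_of_subvector_eq_zero B hx0]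
    simp
  refine ⟨stablyRecovers_of_bound (fun t ht hb hxt => exists_isMinOn_blockL1 B ht hb hxt)
      (fun z hz => aux z fun q => ?_) hc,
    stablyRecovers_of_bound (fun t _ _ hxt => exists_isMinOn_blockL0 B ⟨x, hxt⟩)
      (fun z hz => aux z fun q => ?_) hc⟩
  · have h1 : ‖subvector B z q‖ ≤ blockL1 B z :=
      Finset.single_le_sum (f := fun q => ‖subvector B z q‖) (fun _ _ => norm_nonneg _)
        (Finset.mem_univ q)
    have h2 : blockL1 B x = 0 := by simp [blockL1, hx0]
    exact norm_le_zero_iff.mp (h1.trans (hz.trans h2.le))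
  · rw [blockL0_eq_card, blockL0_eq_card, hx, Finset.card_empty] at hz
    have : blockSupport B z = ∅ := Finset.card_eq_zero.mp (by exact_mod_cast le_antisymm hz (by simp))
    exact notMem_blockSupport.mp (by simp [this])

end BlockSparse

/-! ### Nets of the unit ball in finite dimension. -/

section Net

variable {E : Type*} [NormedAddCommGroup E] [NormedSpace ℝ E]

open Module in
-- Volume comparison: disjoint balls of radius `1/16` inside a ball of radius `17/16`.
lemma card_le_of_eighth_separated [FiniteDimensional ℝ E] (s : Finset E) (hs : ∀ c ∈ s, ‖c‖ ≤ 1)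
    (h : ∀ c ∈ s, ∀ d ∈ s, c ≠ d → 1 / 8 ≤ ‖c - d‖) : s.card ≤ 17 ^ finrank ℝ E := by
  borelize E
  let μ : Measure E := Measure.addHaar
  have hD : (s : Set E).PairwiseDisjoint fun c => Metric.ball c (1 / 16 : ℝ) := by
    rintro c hc d hd hcd
    apply Metric.ball_disjoint_ball
    rw [dist_eq_norm]
    have := h c hc d hd hcd
    linarith
  have hsub : (⋃ c ∈ s, Metric.ball c (1 / 16 : ℝ)) ⊆ Metric.ball (0 : E) (17 / 16) := by
    refine Set.iUnion₂_subset fun x hx => Metric.ball_subset_ball' ?_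
    rw [dist_zero_right]
    linarith [hs x hx]
  have I : (s.card : ℝ≥0∞) * ENNReal.ofReal ((1 / 16) ^ finrank ℝ E) * μ (Metric.ball 0 1) ≤
      ENNReal.ofReal ((17 / 16) ^ finrank ℝ E) * μ (Metric.ball 0 1) :=
    calc
      _ = μ (⋃ c ∈ s, Metric.ball c (1 / 16 : ℝ)) := by
        rw [measure_biUnion_finset hD fun c _ => measurableSet_ball]
        simp only [μ.addHaar_ball_of_pos _ (show (0 : ℝ) < 1 / 16 by norm_num), Finset.sum_const,
          nsmul_eq_mul, mul_assoc]
      _ ≤ μ (Metric.ball (0 : E) (17 / 16)) := measure_mono hsub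
      _ = _ := μ.addHaar_ball_of_pos _ (by norm_num)
  have J := (ENNReal.mul_le_mul_iff_left (Metric.measure_ball_pos μ _ zero_lt_one).ne'
    measure_ball_lt_top.ne).1 I
  have K : (s.card : ℝ) ≤ (17 : ℝ) ^ finrank ℝ E := by
    have h1 := ENNReal.toReal_le_of_le_ofReal (by positivity) J
    rw [ENNReal.toReal_mul, ENNReal.toReal_natCast, ENNReal.toReal_ofReal (by positivity)] at h1
    rw [div_pow, div_pow, one_pow, mul_one_div] at h1
    exact (div_le_div_iff_of_pos_right (by positivity)).mp h1
  exact_mod_cast K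

open Module in
-- A separated set of maximal cardinality is a net, since an uncovered point could be added.
lemma exists_eighth_net [FiniteDimensional ℝ E] : ∃ s : Finset E, s.card ≤ 17 ^ finrank ℝ E ∧ (∀ c ∈ s, ‖c‖ ≤ 1) ∧
    ∀ x : E, ‖x‖ ≤ 1 → ∃ c ∈ s, ‖x - c‖ ≤ 1 / 8 := by
  classical
  let S : Set (Finset E) :=
    {s | (∀ c ∈ s, ‖c‖ ≤ 1) ∧ ∀ c ∈ s, ∀ d ∈ s, c ≠ d → 1 / 8 ≤ ‖c - d‖}
  have hfin : (Finset.card '' S).Finite := (Set.finite_Iic (17 ^ finrank ℝ E)).subset <| by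
    rintro _ ⟨s, hs, rfl⟩
    exact card_le_of_eighth_separated s hs.1 hs.2
  obtain ⟨s, hs, hmax⟩ := Set.exists_max_image (Finset.card '' S) id hfin
    ⟨_, Set.mem_image_of_mem _ (show ∅ ∈ S by simp [S])⟩
  obtain ⟨s, hsS, rfl⟩ := hs
  refine ⟨s, card_le_of_eighth_separated s hsS.1 hsS.2, hsS.1, fun x hx => ?_⟩
  by_contra! hcon
  have hxs : x ∉ s := fun hxs => by
    have := hcon x hxs
    rw [sub_self, norm_zero] at this
    linarith
  have := hmax (insert x s).card <| Set.mem_image_of_mem _ <| by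
    constructor
    · intro c hc
      rcases Finset.mem_insert.mp hc with rfl | hc
      · exact hx
      · exact hsS.1 c hc
    · intro c hc d hd hcd
      rcases Finset.mem_insert.mp hc with rfl | hc' <;>
        rcases Finset.mem_insert.mp hd with rfl | hd'
      · exact absurd rfl hcd
      · exact (hcon d hd').le
      · rw [norm_sub_rev]; exact (hcon c hc').le
      · exact hsS.2 c hc' d hd' hcd
  rw [Finset.card_insert_of_notMem hxs] at this
  simp at this

lemma norm_map_bounds_of_eighth_net {F : Type*} [NormedAddCommGroup F] [NormedSpace ℝ F]
    (L : E →L[ℝ] F) {s : Finset E} (h1 : ∀ c ∈ s, ‖c‖ ≤ 1)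
    (hs : ∀ x : E, ‖x‖ ≤ 1 → ∃ c ∈ s, ‖x - c‖ ≤ 1 / 8) {σ : ℝ} (hσ : 0 ≤ σ)
    (hL : ∀ c ∈ s, σ / 2 * ‖c‖ ≤ ‖L c‖ ∧ ‖L c‖ ≤ 2 * σ * ‖c‖) (x : E) :
    σ / 8 * ‖x‖ ≤ ‖L x‖ ∧ ‖L x‖ ≤ 3 * σ * ‖x‖ := by
  have hop : ‖L‖ ≤ 2 * σ + ‖L‖ / 8 := by
    -- Absorbing `‖L‖ / 8` gives `‖L‖ ≤ 16 σ / 7 ≤ 3 σ`. The lower bound below is then `7 σ / 16 - 2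
    -- σ / 7 ≥ σ / 8`.
    refine L.opNorm_le_of_unit_norm (by positivity) fun x hx => ?_
    obtain ⟨c, hc, hxc⟩ := hs x hx.le
    have h2 : L x = L c + L (x - c) := by rw [← map_add]; congr 1; abel
    rw [h2]
    have h3 := (hL c hc).2
    have h4 := L.le_opNorm (x - c)
    have h5 : ‖L‖ * ‖x - c‖ ≤ ‖L‖ * (1 / 8) := by gcongr
    have h6 : 2 * σ * ‖c‖ ≤ 2 * σ * 1 := by gcongr; exact h1 c hc
    linarith [norm_add_le (L c) (L (x - c))]
  have hunit : ∀ x : E, ‖x‖ = 1 → σ / 8 ≤ ‖L x‖ := by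
    intro x hx
    obtain ⟨c, hc, hxc⟩ := hs x hx.le
    have h2 : L c = L x - L (x - c) := by rw [← map_sub]; congr 1; abel
    have h3 := (hL c hc).1
    have h4 := L.le_opNorm (x - c)
    have h5 : ‖L‖ * ‖x - c‖ ≤ ‖L‖ * (1 / 8) := by gcongr
    have h6 : 7 / 8 ≤ ‖c‖ := by linarith [norm_le_norm_add_norm_sub' x c]
    have h7 : σ / 2 * (7 / 8) ≤ σ / 2 * ‖c‖ := by gcongr
    rw [h2] at h3
    linarith [norm_sub_le (L x) (L (x - c))]
  constructor
  · rcases eq_or_ne x 0 with rfl | hx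
    · simp
    · have h2 := hunit (‖x‖⁻¹ • x) (by
      rw [norm_smul, norm_inv, norm_norm, inv_mul_cancel₀ (norm_ne_zero_iff.mpr hx)])
      rw [map_smul, norm_smul, norm_inv, norm_norm, inv_mul_eq_div,
        le_div_iff₀ (norm_pos_iff.mpr hx)] at h2
      exact h2
  · refine (L.le_opNorm x).trans ?_
    gcongr
    linarith

end Net

/-! ### Chi-square tails by the Chernoff method. -/

section ChiSquare

lemma exp_mul_sq_mul_gaussianPDFReal {v : ℝ≥0} (t x : ℝ) :
    gaussianPDFReal 0 v x * Real.exp (t * x ^ 2) =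
      (√(2 * Real.pi * v))⁻¹ * Real.exp (-(1 / (2 * v) - t) * x ^ 2) := by
  rw [gaussianPDFReal, mul_assoc, ← Real.exp_add]
  congr 2
  rw [sub_zero]
  ring

lemma integral_exp_mul_sq_gaussianReal {v : ℝ≥0} (hv : v ≠ 0) {t : ℝ} (ht : 2 * v * t < 1) :
    ∫ x, Real.exp (t * x ^ 2) ∂gaussianReal 0 v = √(1 / (1 - 2 * v * t)) := by
  have hv' : (0 : ℝ) < v := by exact_mod_cast pos_iff_ne_zero.mpr hv
  have h1 : 0 < 1 - 2 * v * t := by linarith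
  rw [integral_gaussianReal_eq_integral_smul hv]
  simp_rw [smul_eq_mul, exp_mul_sq_mul_gaussianPDFReal]
  rw [integral_const_mul, integral_gaussian, ← Real.sqrt_inv, ← Real.sqrt_mul (by positivity)]
  congr 1
  have h2 : 1 / (2 * (v : ℝ)) - t = (1 - 2 * v * t) / (2 * v) := by field_simp
  rw [h2]
  field_simp

variable {Ω : Type*} [MeasurableSpace Ω] {P : Measure Ω}

lemma ProbabilityTheory.HasLaw.mgf_sq_gaussianReal {Z : Ω → ℝ} {v : ℝ≥0} (hZ : HasLaw Z (gaussianReal 0 v) P)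
    (hv : v ≠ 0) {t : ℝ} (ht : 2 * v * t < 1) :
    mgf (fun ω => Z ω ^ 2) P t = √(1 / (1 - 2 * v * t)) := by
  rw [← integral_exp_mul_sq_gaussianReal hv ht]
  exact hZ.integral_comp (f := fun x => Real.exp (t * x ^ 2)) (by fun_prop)

variable {m : ℕ} {Z : Fin m → Ω → ℝ} {v : ℝ≥0}

lemma mgf_sum_sq_gaussianReal (hi : iIndepFun Z P) (hZ : ∀ i, HasLaw (Z i) (gaussianReal 0 v) P)
    (hv : v ≠ 0) {t : ℝ} (ht : 2 * v * t < 1) :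
    mgf (∑ i, fun ω => Z i ω ^ 2) P t = √(1 / (1 - 2 * v * t)) ^ m := by
  have hi' : iIndepFun (fun i ω => Z i ω ^ 2) P :=
    hi.comp (fun _ x => x ^ 2) fun _ => by fun_prop
  rw [hi'.mgf_sum₀ (fun i => (hZ i).aemeasurable.pow_const 2)]
  rw [Finset.prod_congr rfl fun i _ => (hZ i).mgf_sq_gaussianReal hv ht]
  simp

/-- The integral of a non-integrable function is `0` by convention, but the moment generating
function was computed to be positive. -/
lemma integrable_exp_mul_sum_sq_gaussianReal (hi : iIndepFun Z P)
    (hZ : ∀ i, HasLaw (Z i) (gaussianReal 0 v) P) (hv : v ≠ 0) {t : ℝ} (ht : 2 * v * t < 1) :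
    Integrable (fun ω => Real.exp (t * (∑ i, fun ω => Z i ω ^ 2) ω)) P := by
  have := hi.isProbabilityMeasure
  by_contra h
  have h1 := mgf_sum_sq_gaussianReal hi hZ hv ht
  rw [mgf, integral_undef h] at h1
  have : 0 < √(1 / (1 - 2 * v * t)) ^ m :=
    pow_pos (Real.sqrt_pos.mpr (one_div_pos.mpr (by linarith))) _
  linarith

/-- Both tails of a chi-square variable. -/
lemma measureReal_sum_sq_gaussianReal_le (hi : iIndepFun Z P)
    (hZ : ∀ i, HasLaw (Z i) (gaussianReal 0 v) P) (hv : v ≠ 0) :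
    P.real {ω | ∑ i, Z i ω ^ 2 ≤ m * v / 4} ≤ Real.exp (-(3 / 10) * m) ∧
      P.real {ω | 4 * m * v ≤ ∑ i, Z i ω ^ 2} ≤ Real.exp (-(3 / 10) * m) := by
  have := hi.isProbabilityMeasure
  have hv' : (0 : ℝ) < v := by exact_mod_cast pos_iff_ne_zero.mpr hv
  have hm : (0 : ℝ) ≤ m := Nat.cast_nonneg m
  have hlog := Real.log_two_gt_d9
  have hlog' := Real.log_two_lt_d9
  constructor
  -- With `t = -3 / (2 v)` the mgf is `2⁻ᵐ`, and the exponent is `(3/8 - log 2) m ≤ -(3/10) m`.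
  · have ht : 2 * (v : ℝ) * (-(3 / (2 * v))) < 1 := by field_simp; norm_num
    have h := measure_le_le_exp_mul_mgf (m * v / 4) (by rw [neg_nonpos]; positivity)
      (integrable_exp_mul_sum_sq_gaussianReal hi hZ hv ht)
    rw [mgf_sum_sq_gaussianReal hi hZ hv ht] at h
    simp only [Finset.sum_apply] at h
    refine h.trans ?_
    have h1 : √(1 / (1 - 2 * (v : ℝ) * (-(3 / (2 * v))))) = Real.exp (-Real.log 2) := by
      rw [Real.exp_neg, Real.exp_log (by norm_num)]
      have : 1 - 2 * (v : ℝ) * (-(3 / (2 * v))) = 2 ^ 2 := by field_simp; norm_num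
      rw [this, one_div, Real.sqrt_inv, Real.sqrt_sq (by norm_num)]
    rw [h1, ← Real.exp_nat_mul, ← Real.exp_add, Real.exp_le_exp]
    have h2 : - -(3 / (2 * (v : ℝ))) * (m * v / 4) = 3 / 8 * m := by field_simp; ring
    rw [h2]
    nlinarith
  -- With `t = 1 / (4 v)` the exponent is `(log 2 / 2 - 1) m`.
  · have ht : 2 * (v : ℝ) * (1 / (4 * v)) < 1 := by field_simp; norm_num
    have h := measure_ge_le_exp_mul_mgf (4 * m * v) (by positivity)
      (integrable_exp_mul_sum_sq_gaussianReal hi hZ hv ht)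
    rw [mgf_sum_sq_gaussianReal hi hZ hv ht] at h
    simp only [Finset.sum_apply] at h
    refine h.trans ?_
    have h1 : √(1 / (1 - 2 * (v : ℝ) * (1 / (4 * v)))) = Real.exp (Real.log 2 / 2) := by
      have : 1 / (1 - 2 * (v : ℝ) * (1 / (4 * v))) = 2 := by field_simp; norm_num
      rw [this, Real.exp_half, Real.exp_log (by norm_num)]
    rw [h1, ← Real.exp_nat_mul, ← Real.exp_add, Real.exp_le_exp]
    have h2 : -(1 / (4 * (v : ℝ))) * (4 * m * v) = - m := by field_simp
    rw [h2]
    nlinarith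

end ChiSquare

/-! ### A Gaussian matrix acting on a fixed vector. -/

namespace BlockSparse

variable {Ω : Type*} [MeasurableSpace Ω] {P : Measure Ω} {m n r : ℕ}
  {A : Ω → Matrix (Fin m) (Fin n) ℝ} {v : ℝ≥0}

lemma IsGaussianMatrix.hasGaussianLaw_mulVec (hA : IsGaussianMatrix A v P)
    (y : Fin n → ℝ) : HasGaussianLaw (fun ω i => ∑ j, A ω i j * y j) P := by
  have h := hA.indep.hasGaussianLaw fun ij : Fin m × Fin n => (hA.law ij.1 ij.2).hasGaussianLaw
  let L : (Fin m × Fin n → ℝ) →L[ℝ] (Fin m → ℝ) := ContinuousLinearMap.pi fun i =>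
    ∑ j, y j • ContinuousLinearMap.proj (R := ℝ) (φ := fun _ : Fin m × Fin n => ℝ) (i, j)
  have hL : (fun ω i => ∑ j, A ω i j * y j) = fun ω => L fun ij => A ω ij.1 ij.2 := by
    ext ω i
    simp [L, mul_comm]
  rw [hL]
  exact h.map_fun L

lemma IsGaussianMatrix.covariance_mulVec (hA : IsGaussianMatrix A v P) (y : Fin n → ℝ)
    (i i' : Fin m) : cov[fun ω => ∑ j, A ω i j * y j, fun ω => ∑ j, A ω i' j * y j; P] =
      if i = i' then v * ∑ j, y j ^ 2 else 0 := by
  have hP := hA.indep.isProbabilityMeasure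
  have hL : ∀ i j, MemLp (fun ω => A ω i j) 2 P := fun i j =>
    (hA.law i j).hasGaussianLaw.memLp_two
  rw [covariance_fun_sum_fun_sum (fun j => (hL i j).mul_const _) (fun j => (hL i' j).mul_const _)]
  have hcov : ∀ j j', cov[fun ω => A ω i j * y j, fun ω => A ω i' j' * y j'; P] =
      if (i, j) = (i', j') then v * (y j * y j') else 0 := by
    intro j j'
    rw [covariance_mul_const_left, covariance_mul_const_right]
    split_ifs with hij
    · obtain ⟨rfl, rfl⟩ := Prod.mk.inj hij
      rw [covariance_self (hL i j).aemeasurable, (hA.law i j).variance_eq,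
        variance_id_gaussianReal]
      ring
    · rw [(hA.indep.indepFun hij).covariance_eq_zero (hL i j) (hL i' j')]
      ring
  simp_rw [hcov, Prod.mk.injEq]
  split_ifs with h
  · simp [h, Finset.mul_sum, sq]
  · simp [h]

/-- The coordinates of `A y` are jointly Gaussian and uncorrelated, hence independent. -/
lemma IsGaussianMatrix.iIndepFun_mulVec (hA : IsGaussianMatrix A v P) (y : Fin n → ℝ) :
    iIndepFun (fun i ω => ∑ j, A ω i j * y j) P :=
  (hA.hasGaussianLaw_mulVec y).iIndepFun_of_covariance_eq_zero fun i j hij => by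
    rw [hA.covariance_mulVec, if_neg hij]

lemma IsGaussianMatrix.hasLaw_mulVec (hA : IsGaussianMatrix A v P) (y : EuclideanSpace ℝ (Fin n))
    (i : Fin m) : HasLaw (fun ω => ∑ j, A ω i j * y j) (gaussianReal 0 (v * ‖y‖₊ ^ 2)) P := by
  have hg := (hA.hasGaussianLaw_mulVec y).eval i
  have hP := hA.indep.isProbabilityMeasure
  refine ⟨hg.aemeasurable, ?_⟩
  rw [hg.map_eq_gaussianReal]
  congr 1
  · rw [integral_finsetSum _ fun j _ => (hA.law i j).hasGaussianLaw.integrable.mul_const _]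
    refine Finset.sum_eq_zero fun j _ => ?_
    rw [integral_mul_const, (hA.law i j).integral_eq, integral_id_gaussianReal, zero_mul]
  · rw [← covariance_self hg.aemeasurable, hA.covariance_mulVec, if_pos rfl]
    ext
    rw [Real.coe_toNNReal _ (by positivity)]
    push_cast
    rw [EuclideanSpace.real_norm_sq_eq]

lemma norm_sq_measureCLM (A : Matrix (Fin m) (Fin n) ℝ) (y : EuclideanSpace ℝ (Fin n)) :
    ‖measureCLM A y‖ ^ 2 = ∑ i, (∑ j, A i j * y j) ^ 2 := by
  rw [measureCLM_apply, EuclideanSpace.real_norm_sq_eq]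
  rfl

lemma IsGaussianMatrix.measure_norm_le (hA : IsGaussianMatrix A v P) (hv : v ≠ 0)
    (y : EuclideanSpace ℝ (Fin n)) :
    P {ω | ¬ (√(m * v) / 2 * ‖y‖ ≤ ‖measureCLM (A ω) y‖ ∧
      ‖measureCLM (A ω) y‖ ≤ 2 * √(m * v) * ‖y‖)} ≤
      ENNReal.ofReal (2 * Real.exp (-(3 / 10) * m)) := by
  have hP := hA.indep.isProbabilityMeasure
  rcases eq_or_ne y 0 with rfl | hy
  · simp
  have hv2 : v * ‖y‖₊ ^ 2 ≠ 0 := mul_ne_zero hv (pow_ne_zero _ (nnnorm_ne_zero_iff.mpr hy))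
  obtain ⟨h1, h2⟩ := measureReal_sum_sq_gaussianReal_le (hA.iIndepFun_mulVec y)
    (hA.hasLaw_mulVec y) hv2
  simp_rw [← norm_sq_measureCLM] at h1 h2
  rw [← ofReal_measureReal]
  refine ENNReal.ofReal_le_ofReal ?_
  rw [two_mul (Real.exp _)]
  refine le_trans ?_ (add_le_add h1 h2)
  refine le_trans (measureReal_mono ?_) (measureReal_union_le _ _)
  intro ω hω
  rw [Set.mem_ofPred_eq, not_and_or, not_le, not_le] at hω
  have hs : √((m : ℝ) * v) ^ 2 = m * v := Real.sq_sqrt (by positivity)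
  push_cast
  rcases hω with hω | hω
  · left
    have := pow_le_pow_left₀ (norm_nonneg _) hω.le 2
    rw [mul_pow, div_pow, hs] at this
    rw [Set.mem_ofPred_eq]
    linarith
  · right
    have := pow_le_pow_left₀ (by positivity) hω.le 2
    rw [mul_pow, mul_pow, hs] at this
    rw [Set.mem_ofPred_eq]
    linarith

end BlockSparse

/-! ### Union bound, sparsity of the signal, and failure probability. -/

namespace BlockSparse

variable {Ω : Type*} [MeasurableSpace Ω] {P : Measure Ω} {m n r d : ℕ}
  {A : Ω → Matrix (Fin m) (Fin n) ℝ} {v : ℝ≥0} {B : Fin n → Fin r} {p : ℝ}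

/-- The space of the vectors that vanish outside of the blocks in `T`. -/
def supportedOn (B : Fin n → Fin r) (T : Finset (Fin r)) :
    Submodule ℝ (EuclideanSpace ℝ (Fin n)) where
  carrier := {h | ∀ i, B i ∉ T → h i = 0}
  add_mem' := fun {a b} ha hb i hi => by rw [PiLp.add_apply, ha i hi, hb i hi, add_zero]
  zero_mem' := fun _ _ => rfl
  smul_mem' := fun c a ha i hi => by rw [PiLp.smul_apply, ha i hi, smul_zero]

lemma restrict_mem_supportedOn (B : Fin n → Fin r) (T : Finset (Fin r))
    (h : EuclideanSpace ℝ (Fin n)) : restrict B T h ∈ supportedOn B T :=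
  fun i hi => by rw [restrict_apply, if_neg hi]

lemma IsBlockStructure.finrank_supportedOn_le (hB : IsBlockStructure B d) (T : Finset (Fin r)) :
    Module.finrank ℝ (supportedOn B T) ≤ T.card * d := by
  let f : supportedOn B T →ₗ[ℝ] ({i : Fin n // B i ∈ T} → ℝ) :=
    { toFun := fun h i => h.1 i.1
      map_add' := fun _ _ => rfl
      map_smul' := fun _ _ => rfl }
  have hf : Function.Injective f := by
    intro a b hab
    ext i
    by_cases hi : B i ∈ T
    · exact congrFun hab ⟨i, hi⟩
    · rw [a.2 i hi, b.2 i hi]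
  refine (LinearMap.finrank_le_finrank_of_injective hf).trans (le_of_eq ?_)
  rw [Module.finrank_fintype_fun_eq_card, Fintype.card_subtype,
    Finset.card_eq_sum_card_fiberwise (f := B) (t := T) (fun i hi => by simpa using hi)]
  rw [Finset.sum_congr rfl (g := fun _ => d), Finset.sum_const, smul_eq_mul]
  intro q hq
  rw [← hB q, Fintype.card_subtype]
  congr 1
  ext i
  simp only [Finset.mem_filter, Finset.mem_univ, true_and]
  exact ⟨fun h => h.2, fun h => ⟨h ▸ hq, h⟩⟩

/-- Weight each `T` by `p ^ |T|`: the counted sets have weight at least `p ^ K`, and the total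
weight is `(1 + p) ^ r ≤ exp (p r)`. -/
lemma card_filter_card_le (r : ℕ) {K : ℝ} (hp : 0 < p) (hp1 : p ≤ 1) :
    ((Finset.univ.filter fun T : Finset (Fin r) => (T.card : ℝ) ≤ K).card : ℝ) ≤
      Real.exp (K * Real.log (1 / p) + p * r) := by
  have hlog : 0 ≤ Real.log (1 / p) := Real.log_nonneg ((one_le_div hp).mpr hp1)
  have hsum := Fintype.sum_pow_mul_eq_add_pow (Fin r) p 1
  simp only [one_pow, mul_one, Fintype.card_fin] at hsum
  have h1 : ∀ T ∈ Finset.univ.filter fun T : Finset (Fin r) => (T.card : ℝ) ≤ K,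
      Real.exp (-(K * Real.log (1 / p))) ≤ p ^ T.card := by
    intro T hT
    have hp' : p = Real.exp (-Real.log (1 / p)) := by
      rw [one_div, Real.log_inv, neg_neg, Real.exp_log hp]
    conv_rhs => rw [hp', ← Real.exp_nat_mul]
    rw [Real.exp_le_exp]
    have := mul_le_mul_of_nonneg_right (Finset.mem_filter.mp hT).2 hlog
    linarith
  have h2 := Finset.card_nsmul_le_sum _ _ _ h1
  have h3 : ∑ T ∈ Finset.univ.filter (fun T : Finset (Fin r) => (T.card : ℝ) ≤ K), p ^ T.card ≤
      ∑ T : Finset (Fin r), p ^ T.card :=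
    Finset.sum_le_sum_of_subset_of_nonneg (Finset.filter_subset _ _) fun _ _ _ => by positivity
  have h4 : (p + 1) ^ r ≤ Real.exp (p * r) := by
    rw [mul_comm, Real.exp_nat_mul]
    exact pow_le_pow_left₀ (by positivity) (Real.add_one_le_exp p) r
  rw [nsmul_eq_mul, Real.exp_neg, ← div_eq_mul_inv, div_le_iff₀ (Real.exp_pos _)] at h2
  rw [add_comm (K * _), Real.exp_add]
  refine h2.trans ?_
  gcongr
  exact h3.trans (hsum.le.trans h4)

lemma IsGaussianMatrix.measure_not_restrictedIsometry_le (hA : IsGaussianMatrix A v P)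
    (hv : v ≠ 0) (hB : IsBlockStructure B d) (hp : 0 < p) (hp1 : p ≤ 1) (K : ℝ) :
    P {ω | ¬ RestrictedIsometry B (A ω) √(m * v) K} ≤
      ENNReal.ofReal (2 * Real.exp (K * Real.log (1 / p) + p * r + 3 * (K * d) - 3 / 10 * m)) := by
  classical
  choose N hNcard hN1 hN using fun T : Finset (Fin r) => exists_eighth_net (E := supportedOn B T)
  set 𝒯 := Finset.univ.filter fun T : Finset (Fin r) => (T.card : ℝ) ≤ K with h𝒯
  let bad (y : EuclideanSpace ℝ (Fin n)) : Set Ω :=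
    {ω | ¬ (√(m * v) / 2 * ‖y‖ ≤ ‖measureCLM (A ω) y‖ ∧
      ‖measureCLM (A ω) y‖ ≤ 2 * √(m * v) * ‖y‖)}
  have hsub : {ω | ¬ RestrictedIsometry B (A ω) √(m * v) K} ⊆
      ⋃ T ∈ 𝒯, ⋃ c ∈ N T, bad c := by
    intro ω hω
    by_contra hcon
    simp only [Set.mem_iUnion, not_exists] at hcon
    refine hω fun T hT h => ?_
    exact norm_map_bounds_of_eighth_net ((measureCLM (A ω)).comp (supportedOn B T).subtypeL)
      (hN1 T) (hN T) (Real.sqrt_nonneg _)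
      (fun c hc => not_not.mp (hcon T (by simpa [h𝒯] using hT) c hc))
      ⟨restrict B T h, restrict_mem_supportedOn B T h⟩
  -- A net has at most `17 ^ (K d) ≤ exp (3 K d)` points.
  have hexp : (17 : ℝ) ≤ Real.exp 3 := by
    have := Real.exp_one_gt_d9
    have h3 : Real.exp 3 = Real.exp 1 ^ 3 := by rw [← Real.exp_nat_mul]; norm_num
    rw [h3]
    refine le_trans ?_ (pow_le_pow_left₀ (by norm_num) this.le 3)
    norm_num
  have hbad : ∀ y, P (bad y) ≤ ENNReal.ofReal (2 * Real.exp (-(3 / 10) * m)) :=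
    fun y => hA.measure_norm_le hv y
  have hnet : ∀ T ∈ 𝒯, P (⋃ c ∈ N T, bad c) ≤
      ENNReal.ofReal (Real.exp (3 * (K * d)) * (2 * Real.exp (-(3 / 10) * m))) := by
    intro T hT
    refine (measure_biUnion_finset_le _ _).trans ((Finset.sum_le_card_nsmul (N T) _ _ fun c _ =>
      hbad (c : EuclideanSpace ℝ (Fin n))).trans ?_)
    rw [nsmul_eq_mul, ← ENNReal.ofReal_natCast, ← ENNReal.ofReal_mul (Nat.cast_nonneg _)]
    refine ENNReal.ofReal_le_ofReal ?_
    gcongr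
    have h1 : ((N T).card : ℝ) ≤ 17 ^ (T.card * d) := by
      have h2 := (hNcard T).trans
        (Nat.pow_le_pow_right (by norm_num) (hB.finrank_supportedOn_le T))
      exact_mod_cast h2
    refine h1.trans ((pow_le_pow_left₀ (by norm_num) hexp _).trans ?_)
    rw [← Real.exp_nat_mul, Real.exp_le_exp]
    push_cast
    have h3 : (T.card : ℝ) * d ≤ K * d := by
      gcongr
      exact (Finset.mem_filter.mp hT).2
    linarith
  refine (measure_mono hsub).trans ((measure_biUnion_finset_le _ _).trans
    ((Finset.sum_le_card_nsmul _ _ _ hnet).trans ?_))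
  rw [nsmul_eq_mul, ← ENNReal.ofReal_natCast, ← ENNReal.ofReal_mul (Nat.cast_nonneg _)]
  refine ENNReal.ofReal_le_ofReal ?_
  refine (mul_le_mul_of_nonneg_right (card_filter_card_le r hp hp1) (by positivity)).trans
    (le_of_eq ?_)
  rw [mul_left_comm (Real.exp (3 * (K * d))), mul_left_comm, ← Real.exp_add, ← Real.exp_add]
  congr 2
  ring

/-- Markov's inequality; each block is nonzero with probability at most `p`. -/
lemma IsBlockBernoulliGaussian.mul_measure_le_card_blockSupport_le
    {x : Ω → EuclideanSpace ℝ (Fin n)} (hx : IsBlockBernoulliGaussian B p x P) (S : ℝ) :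
    ENNReal.ofReal S * P {ω | S ≤ (blockSupport B (x ω)).card} ≤ r * ENNReal.ofReal p := by
  let f (q : Fin r) (ω : Ω) : ℝ≥0∞ := Set.indicator {0}ᶜ 1 (subvector B (x ω) q)
  have hmeas (q : Fin r) : Measurable (Set.indicator {0}ᶜ 1 :
      EuclideanSpace ℝ {i : Fin n // B i = q} → ℝ≥0∞) :=
    measurable_one.indicator (measurableSet_singleton 0).compl
  have hf : ∀ q, AEMeasurable (f q) P := fun q =>
    (hmeas q).comp_aemeasurable (hx.law q).aemeasurable
  have hint : ∀ q, ∫⁻ ω, f q ω ∂P ≤ ENNReal.ofReal p := by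
    intro q
    have h1 := (hx.law q).lintegral_comp (hmeas q).aemeasurable
    refine (h1.trans ?_).le.trans (mul_le_of_le_one_right' (prob_le_one (μ := stdGaussian _)
      (s := ({0}ᶜ : Set (EuclideanSpace ℝ {i : Fin n // B i = q})))))
    rw [lintegral_indicator_one (measurableSet_singleton 0).compl]
    simp
  have hcard : ∀ ω, ∑ q, f q ω = ((blockSupport B (x ω)).card : ℝ≥0∞) := by
    classical
    intro ω
    simp only [f, blockSupport, Set.indicator_apply, Set.mem_compl_iff, Set.mem_singleton_iff,
      Pi.one_apply, Finset.sum_boole]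
  calc ENNReal.ofReal S * P {ω | S ≤ (blockSupport B (x ω)).card}
      ≤ ENNReal.ofReal S * P {ω | ENNReal.ofReal S ≤ ∑ q, f q ω} := by
        gcongr with ω
        intro h
        rw [hcard, ← ENNReal.ofReal_natCast]
        exact ENNReal.ofReal_le_ofReal h
    _ ≤ ∫⁻ ω, ∑ q, f q ω ∂P :=
        mul_meas_ge_le_lintegral₀ (Finset.aemeasurable_fun_sum _ fun q _ => hf q) _
    _ = ∑ q, ∫⁻ ω, f q ω ∂P := lintegral_finsetSum' _ fun q _ => hf q
    _ ≤ ∑ _q : Fin r, ENNReal.ofReal p := Finset.sum_le_sum fun q _ => hint q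
    _ = r * ENNReal.ofReal p := by simp

/-- Failure probability of block-sparse recovery in terms of the redundancy. -/
lemma measure_not_stablyRecovers_le {x : Ω → EuclideanSpace ℝ (Fin n)} (hn : n = r * d)
    (hB : IsBlockStructure B d) (hp : 0 < p) (hp1 : p ≤ 1) (hv : v ≠ 0)
    (hA : IsGaussianMatrix A v P) (hx : IsBlockBernoulliGaussian B p x P)
    (hd : Real.log (1 / p) ≤ d) (hβ : 10 ^ 12 ≤ redundancy m n p) :
    P {ω | ¬ (StablyRecovers (blockL1 B) (A ω) (x ω) (64 / √(m * v)) ∧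
        StablyRecovers (blockL0 B) (A ω) (x ω) (64 / √(m * v)))} ≤
      ENNReal.ofReal (1 / √(redundancy m n p) + 2 * Real.exp (-√(redundancy m n p) / 5)) := by
  set β := redundancy m n p with hβ_def
  set b := √β with hb_def
  have hβpos : 0 < β := lt_of_lt_of_le (by norm_num) hβ
  have hb2 : b ^ 2 = β := Real.sq_sqrt hβpos.le
  have hbge : 10 ^ 6 ≤ b := Real.le_sqrt_of_sq_le (by linarith)
  have hnp : (n : ℝ) * p ≠ 0 := fun h => by
    rw [hβ_def, redundancy, h, div_zero] at hβpos
    exact lt_irrefl _ hβpos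
  have hm : (m : ℝ) = β * (r * d * p) := by
    rw [hβ_def, redundancy, div_mul_eq_mul_div, eq_div_iff hnp, hn]
    push_cast
    ring
  have hn0 : n ≠ 0 := fun h => hnp (by simp [h])
  have hr : 0 < r := Nat.pos_of_ne_zero fun h => hn0 (by simp [hn, h])
  have hdpos : 0 < d := Nat.pos_of_ne_zero fun h => hn0 (by simp [hn, h])
  have hr' : (0 : ℝ) < r := by exact_mod_cast hr
  have hd1 : (1 : ℝ) ≤ d := by exact_mod_cast hdpos
  have hmpos : (0 : ℝ) < m := by rw [hm]; positivity
  have hvpos : (0 : ℝ) < v := by exact_mod_cast pos_iff_ne_zero.mpr hv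
  have hs : 0 < √((m : ℝ) * v) := Real.sqrt_pos.mpr (by positivity)
  -- The geometric mean of the expected sparsity bound `r p` and `m / d = β r p`: a factor `b`
  -- remains on either side.
  set S := b * (r * p) with hS
  have hSpos : 0 < S := by positivity
  have hSd : b * (S * d) = m := by rw [hm, hS, ← hb2]; ring
  have hmarkov : P {ω | S ≤ (blockSupport B (x ω)).card} ≤ ENNReal.ofReal (1 / b) := by
    have h1 := hx.mul_measure_le_card_blockSupport_le S
    rw [mul_comm, ← ENNReal.le_div_iff_mul_le (.inl (by simpa using hSpos))
      (.inl ENNReal.ofReal_ne_top), ← ENNReal.ofReal_natCast,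
      ← ENNReal.ofReal_mul (Nat.cast_nonneg _), ← ENNReal.ofReal_div_of_pos hSpos] at h1
    refine h1.trans (ENNReal.ofReal_le_ofReal (le_of_eq ?_))
    rw [hS]
    field_simp
  -- If `S < 1`, fewer than `S` nonzero blocks means none. Otherwise `m = b S d ≥ b`, so a bound
  -- exponential in `m` is one in `b`.
  by_cases hS1 : S < 1
  · refine (measure_mono ?_).trans (hmarkov.trans (ENNReal.ofReal_le_ofReal ?_))
    · intro ω hω
      rw [Set.mem_ofPred_eq] at hω ⊢
      by_contra hlt
      have h0 : (blockSupport B (x ω)).card < 1 := by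
        have := (not_le.mp hlt).trans hS1
        exact_mod_cast this
      exact hω (stablyRecovers_of_blockSupport_eq_empty _
        (Finset.card_eq_zero.mp (by omega)) (by positivity))
    · linarith [Real.exp_pos (-b / 5)]
  · have hrip := hA.measure_not_restrictedIsometry_le hv hB hp hp1 (2305 * S)
    rw [ENNReal.ofReal_add (by positivity) (by positivity)]
    refine le_trans (le_trans (measure_mono ?_) (measure_union_le _ _))
      (add_le_add hmarkov (hrip.trans (ENNReal.ofReal_le_ofReal ?_)))
    · intro ω hω
      by_contra hcon
      rw [Set.mem_union, not_or, Set.mem_ofPred_eq, Set.mem_ofPred_eq, not_not, not_le] at hcon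
      exact hω (hcon.2.stablyRecovers hs (by linarith [hcon.1]))
    · gcongr
      have h1 : S * Real.log (1 / p) ≤ S * d := by gcongr
      have h2 : 10 ^ 6 * (S * d) ≤ m := by rw [← hSd]; gcongr
      have h3 : p * r ≤ S * d := by
        calc p * r = 1 * (r * p) * 1 := by ring
          _ ≤ b * (r * p) * d := by gcongr; linarith
          _ = S * d := by rw [hS]
      have h4 : b ≤ m := by
        rw [← hSd]
        exact le_mul_of_one_le_right (by positivity)
          (one_le_mul_of_one_le_of_one_le (not_lt.mp hS1) hd1)
      -- The positive terms total at most `(2305 + 1 + 6915) S d ≤ m / 100`, so the exponent is at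
      -- most `-m / 5 ≤ -b / 5`.
      nlinarith

end BlockSparse

/-! ### Passage to the limit. -/

theorem proposition1 :
    ∃ C : ℝ, 0 < C ∧
      ∀ (n r d m : ℕ → ℕ) (p : ℕ → ℝ) (v : ℕ → ℝ≥0)
        (B : ∀ k, Fin (n k) → Fin (r k))
        (Ω : ℕ → Type*) [∀ k, MeasurableSpace (Ω k)]
        (P : ∀ k, Measure (Ω k)) [∀ k, IsProbabilityMeasure (P k)]
        (A : ∀ k, Ω k → Matrix (Fin (m k)) (Fin (n k)) ℝ)
        (x : ∀ k, Ω k → EuclideanSpace ℝ (Fin (n k))),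
        (∀ k, n k = r k * d k) →
        (∀ k, BlockSparse.IsBlockStructure (B k) (d k)) →
        (∀ k, 0 < p k ∧ p k ≤ 1 / 2) →
        (∀ k, v k ≠ 0) →
        (∀ k, BlockSparse.IsGaussianMatrix (A k) (v k) (P k)) →
        (∀ k, BlockSparse.IsBlockBernoulliGaussian (B k) (p k) (x k) (P k)) →
        Tendsto n atTop atTop →
        (fun k => Real.log (1 / p k)) =o[atTop] (fun k => (d k : ℝ) / Real.log (d k)) →
        Tendsto (fun k => BlockSparse.redundancy (m k) (n k) (p k)) atTop atTop →
        Tendsto (fun k => P k {ω | ¬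
            (BlockSparse.StablyRecovers (BlockSparse.blockL1 (B k)) (A k ω) (x k ω)
                (C / √(m k * v k)) ∧
              BlockSparse.StablyRecovers (BlockSparse.blockL0 (B k)) (A k ω) (x k ω)
                (C / √(m k * v k)))})
          atTop (𝓝 0) := by
  refine ⟨64, by norm_num, ?_⟩
  intro n r d m p v B Ω _ P _ A x hn hB hp hv hA hx _ hd hβ
  have hlim : Tendsto (fun k => ENNReal.ofReal
      (1 / √(BlockSparse.redundancy (m k) (n k) (p k)) +
        2 * Real.exp (-√(BlockSparse.redundancy (m k) (n k) (p k)) / 5))) atTop (𝓝 0) := by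
    have hs := Real.tendsto_sqrt_atTop.comp hβ
    have h1 : Tendsto (fun y : ℝ => 1 / y + 2 * Real.exp (-y / 5)) atTop (𝓝 (0 + 2 * 0)) := by
      refine (tendsto_const_nhds.div_atTop tendsto_id).add (Tendsto.const_mul 2 ?_)
      refine Real.tendsto_exp_atBot.comp ?_
      exact (tendsto_neg_atTop_atBot).atBot_div_const (by norm_num)
    have h2 := ENNReal.tendsto_ofReal (h1.comp hs)
    simpa using h2
  refine tendsto_of_tendsto_of_tendsto_of_le_of_le' tendsto_const_nhds hlim
    (Eventually.of_forall fun _ => zero_le) ?_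
  filter_upwards [hβ.eventually_ge_atTop (10 ^ 12),
    hd.bound (show (0 : ℝ) < 1 / 2 by norm_num)] with k hk hdk
  refine BlockSparse.measure_not_stablyRecovers_le (hn k) (hB k) (hp k).1
    ((hp k).2.trans (by norm_num)) (hv k) (hA k) (hx k) ?_ hk
  refine (Real.le_norm_self _).trans (hdk.trans ?_)
  have hlog : 0 ≤ Real.log (d k) := Real.log_natCast_nonneg _
  rw [Real.norm_of_nonneg (by positivity)]
  rcases le_or_gt (d k) 1 with h | h
  -- For `d ≤ 1` the quotient by `log d = 0` is `0` by convention, so the bound is trivial.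
  · have : Real.log (d k) = 0 := by
      interval_cases d k <;> simp
    simp [this]
  · have h2 : (2 : ℝ) ≤ d k := by exact_mod_cast h
    have h3 : 1 / 2 ≤ Real.log (d k) := by
      have := Real.log_le_log (by norm_num) h2
      linarith [Real.log_two_gt_d9]
    rw [← mul_div_assoc, div_le_iff₀ (by linarith)]
    have : (0 : ℝ) ≤ d k := by positivity
    nlinarith
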